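/- Let $n\ge 2$, $V=\{1,\dots,n\}$, and let $\mathcal G(t)=(V,\mathcal E(t))$, $t=0,1,2,\dots$, be an arbitrary sequence of simple undirected graphs, fixed in advance (independently of the process below). Let $m_t=|\mathcal E(t)|$, let $d_t(u)$ be the degree of $u$ in $\mathcal G(t)$ and $D_t$ the diameter of $\mathcal G(t)$. Assume that, for every $t$, the graph $\mathcal G(t)$ is connected and $$d_t(u)+d_t(v)\le m_t\qquad\text{for all } \{u,v\}\in\mathcal E(t).$$ Consider unbiased quantized consensus on this sequence: every agent $i\in V$ has a positive integer initial opinion $x_i(0)$; at each time $t=0,1,2,\dots$ an edge $\{i,j\}\in\mathcal E(t)$ is chosen uniformly at random, independently of the other choices, and its two ends update by $$x_i(t+1)=\begin{cases}x_i(t)-1,& x_i(t)>x_j(t),\\ x_i(t)+1,& x_i(t)<x_j(t),\\ x_i(t),& x_i(t)=x_j(t),\end{cases}$$ and likewise for $j$ with the roles of $i$ and $j$ exchanged, while all other opinions are unchanged. Let $$T=\inf\{t\ge 0:\ \text{there is } c\in\mathbb Z \text{ with } x_i(t)\in\{c,c+1\} \text{ for all } i\in V\}$$ be the convergence time ($T=\infty$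 if there is no such $t$), and put $m_{\max}=\max_{t\ge0}m_t$, $D_{\max}=\max_{t\ge0}D_t$, $L=\max_i x_i(0)$, $l=\min_i x_i(0)$. Then there is an absolute constant $C>0$ (independent of $n$, of the graphs and of the initial opinions) such that $$\mathbb E[T]\ \le\ C\,(L-l)^2\,n^2\,m_{\max}\,D_{\max}\,\ln^2(n).$$ In particular, when $L-l$ is bounded, the expected convergence time is $O\big(n^2 m_{\max}D_{\max}\ln^2(n)\big)$. -/

import Mathlib

open MeasureTheory ProbabilityTheory
open scoped ENNReal

namespace QuantizedConsensus

/-- The set of unordered pairs of agents is finite; it carries the discrete `σ`-algebra. -/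
instance instMeasurableSpaceSym2 (V : Type*) : MeasurableSpace (Sym2 V) := ⊤

/-- The new opinion of an agent with opinion `a` that interacts with an agent with opinion `b`. -/
def nudge (a b : ℤ) : ℤ :=
  if a > b then a - 1 else if a < b then a + 1 else a

/-- The profile after agents `i` and `j` have interacted. -/
def updatePair {V : Type*} [DecidableEq V] (x : V → ℤ) (i j : V) : V → ℤ := fun k =>
  if k = i then nudge (x i) (x j) else if k = j then nudge (x j) (x i) else x k

theorem updatePair_comm {V : Type*} [DecidableEq V] (x : V → ℤ) (i j : V) :
    updatePair x i j = updatePair x j i := by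
  funext k
  unfold updatePair
  by_cases h1 : k = i
  · by_cases h2 : k = j
    · subst h1; subst h2; rfl
    · simp only [h1, if_true]
      subst h1
      simp [h2]
  · by_cases h2 : k = j
    · subst h2
      simp [h1]
    · simp [h1, h2]

/-- The profile after the edge `e` has been selected: its two ends update their opinions, all
other agents keep theirs. -/
def update {V : Type*} [DecidableEq V] (x : V → ℤ) (e : Sym2 V) : V → ℤ :=
  Sym2.lift ⟨updatePair x, updatePair_comm x⟩ e

/-- The profile at time `t`, when `e s` is the edge selected at time `s`. -/
def profile {V : Type*} [DecidableEq V] (x₀ : V → ℤ) (e : ℕ → Sym2 V) : ℕ → V → ℤ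
  | 0 => x₀
  | t + 1 => update (profile x₀ e t) (e t)

/-- Quantized consensus: all opinions lie in `{c, c + 1}` for some integer `c`. -/
def IsQuantizedConsensus {V : Type*} (x : V → ℤ) : Prop :=
  ∃ c : ℤ, ∀ i, x i = c ∨ x i = c + 1

/-- The first time at which the profile is a quantized consensus (`⊤` if there is none). -/
noncomputable def convergenceTime {V : Type*} [DecidableEq V] (x₀ : V → ℤ)
    (e : ℕ → Sym2 V) : ℕ∞ :=
  ⨅ (t : ℕ) (_ : IsQuantizedConsensus (profile x₀ e t)), (t : ℕ∞)

/-- The random edges `e 0, e 1, …` are independent, and `e t` is uniformly distributed on the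
edges of `G t`. -/
structure IsUniformEdgeSelection {V : Type*} (G : ℕ → SimpleGraph V) {Ω : Type*}
    [MeasurableSpace Ω] (μ : Measure Ω) (e : ℕ → Ω → Sym2 V) : Prop where
  measurable : ∀ t, Measurable (e t)
  indep : iIndepFun e μ
  law : ∀ t, μ.map (e t) = uniformOn (G t).edgeSet

/-- `m_max = max_t m_t`, the largest number of edges. -/
noncomputable def maxEdges {n : ℕ} (G : ℕ → SimpleGraph (Fin n))
    [∀ t, DecidableRel (G t).Adj] : ℕ :=
  ⨆ t, (G t).edgeFinset.card

/-- `D_max = max_t D_t`, the largest diameter. -/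
noncomputable def maxDiam {n : ℕ} (G : ℕ → SimpleGraph (Fin n)) : ℕ :=
  ⨆ t, (G t).diam

/-- The largest number of edges is attained, so `maxEdges` is a true maximum. -/
theorem isGreatest_maxEdges {n : ℕ} (G : ℕ → SimpleGraph (Fin n))
    [∀ t, DecidableRel (G t).Adj] :
    IsGreatest (Set.range fun t => (G t).edgeFinset.card) (maxEdges G) := by
  have hb : BddAbove (Set.range fun t => (G t).edgeFinset.card) := by
    refine ⟨Fintype.card (Sym2 (Fin n)), ?_⟩
    rintro _ ⟨t, rfl⟩
    exact Finset.card_le_univ _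
  exact ⟨Nat.sSup_mem (Set.range_nonempty _) hb, fun _ h => le_csSup hb h⟩

/-- The largest diameter is attained, so `maxDiam` is a true maximum. -/
theorem isGreatest_maxDiam {n : ℕ} (G : ℕ → SimpleGraph (Fin n)) :
    IsGreatest (Set.range fun t => (G t).diam) (maxDiam G) := by
  have hf : (Set.range fun t => (G t).diam).Finite :=
    (Set.finite_range (fun H : SimpleGraph (Fin n) => H.diam)).subset
      (by rintro _ ⟨t, rfl⟩; exact ⟨G t, rfl⟩)
  exact ⟨Nat.sSup_mem (Set.range_nonempty _) hf.bddAbove, fun _ h => le_csSup hf.bddAbove h⟩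

/-- `L - l`, where `L` and `l` are the largest and the smallest opinion of a profile. -/
noncomputable def spread {n : ℕ} (x : Fin n → ℤ) : ℤ :=
  (⨆ i, x i) - ⨅ i, x i

end QuantizedConsensus

namespace QuantizedConsensus

/-! Opinions that differ by at most one merely trade places when they meet, so until a pair at
distance at least two meets, the profile is carried by the interchange process of the graphs. When
such a pair does meet, the integer sum of squares `deviation c` falls by at least one. Outside
consensus some two agents differ by at least two. Follow them as tokens moved by the transpositions:
the deviation must drop no later than the moment they meet. Hence each drop costs at most one
expected meeting time (`waiting_le_add_sum_survival`), and with `c` the smallest opinion there are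
at most `n * spread ^ 2` drops (`waiting_le_mul`, `deviation_iInf_le`).

The meeting time is controlled spectrally. The pair process killed on meeting has, for each graph, a
self-adjoint operator on functions vanishing on the diagonal. With one token frozen at `v`, such a
function vanishes at `v`, so a shortest-path Poincaré inequality bounds its square norm by `n * D`
times its Dirichlet energy, and one step dissipates at least a fraction `1 / m` of that energy. This
gives the `ℓ²` contraction factor `1 - 1 / (n * D * m)` for every graph (`sum_sq_meetOp_le`). The
factors multiply along any sequence of graphs, and summing the survival probabilities gives a
meeting time of order `n * m * D * log n`. -/

/-- The squared increment of a function along an edge. -/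
def sqDiff {V : Type*} (g : V → ℝ) (e : Sym2 V) : ℝ :=
  Sym2.lift ⟨fun a b => (g a - g b) ^ 2, fun a b => by ring⟩ e

@[simp] theorem sqDiff_mk {V : Type*} (g : V → ℝ) (a b : V) : sqDiff g s(a, b) = (g a - g b) ^ 2 := rfl

/-! ### Two tokens under the interchange process, killed on meeting. -/

section TokenPairs

variable {V : Type*} [DecidableEq V]

/-- The transposition of the two ends of an edge. -/
def edgeSwap (e : Sym2 V) : Equiv.Perm V :=
  Sym2.lift ⟨Equiv.swap, Equiv.swap_comm⟩ e

@[simp] theorem edgeSwap_mk (a b : V) : edgeSwap s(a, b) = Equiv.swap a b := rfl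

@[simp] theorem edgeSwap_edgeSwap (e : Sym2 V) (v : V) : edgeSwap e (edgeSwap e v) = v := by
  induction e with
  | h a b => simp

/-- The permutation of the pairs of vertices induced by the transposition along an edge. -/
def pairSwap (e : Sym2 V) : Equiv.Perm (V × V) :=
  (edgeSwap e).prodCongr (edgeSwap e)

@[simp] theorem pairSwap_mk (e : Sym2 V) (u v : V) :
    pairSwap e (u, v) = (edgeSwap e u, edgeSwap e v) := rfl

@[simp] theorem pairSwap_pairSwap (e : Sym2 V) (p : V × V) : pairSwap e (pairSwap e p) = p := by
  obtain ⟨u, v⟩ := p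
  simp

/-- Transposing along `e` preserves the killed set, which makes each step symmetric. -/
theorem sym2_pairSwap_eq_iff (e : Sym2 V) (p : V × V) :
    s((pairSwap e p).1, (pairSwap e p).2) = e ↔ s(p.1, p.2) = e := by
  have key : ∀ q : V × V, s(q.1, q.2) = e → s((pairSwap e q).1, (pairSwap e q).2) = e := by
    rintro ⟨u, v⟩ rfl
    simp [Sym2.eq_swap]
  refine ⟨fun h => ?_, key p⟩
  simpa using key _ h

/-- The effect of selecting the edge `e` on a function of the positions of two tokens: the tokens
are moved by the transposition along `e`, and killed if `e` joins them. -/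
def tokenStep (e : Sym2 V) (f : V × V → ℝ) (p : V × V) : ℝ :=
  if s(p.1, p.2) = e then 0 else f (pairSwap e p)

theorem tokenStep_nonneg {e : Sym2 V} {f : V × V → ℝ} (hf : ∀ p, 0 ≤ f p) (p : V × V) :
    0 ≤ tokenStep e f p := by
  unfold tokenStep
  split_ifs
  exacts [le_rfl, hf _]

theorem tokenStep_le_one {e : Sym2 V} {f : V × V → ℝ} (hf : ∀ p, f p ≤ 1) (p : V × V) :
    tokenStep e f p ≤ 1 := by
  unfold tokenStep
  split_ifs
  exacts [zero_le_one, hf _]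

theorem tokenStep_diag {e : Sym2 V} {f : V × V → ℝ} (hf : ∀ v, f (v, v) = 0) (v : V) :
    tokenStep e f (v, v) = 0 := by
  simp [tokenStep, hf]

theorem tokenStep_add (e : Sym2 V) (f g : V × V → ℝ) (p : V × V) :
    tokenStep e (fun q => f q + g q) p = tokenStep e f p + tokenStep e g p := by
  unfold tokenStep
  split_ifs <;> simp

theorem tokenStep_sub (e : Sym2 V) (f g : V × V → ℝ) (p : V × V) :
    tokenStep e (fun q => f q - g q) p = tokenStep e f p - tokenStep e g p := by
  unfold tokenStep
  split_ifs <;> simp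

theorem tokenStep_smul (e : Sym2 V) (c : ℝ) (f : V × V → ℝ) (p : V × V) :
    tokenStep e (fun q => c * f q) p = c * tokenStep e f p := by
  unfold tokenStep
  split_ifs <;> simp

theorem tokenStep_sum {ι : Type*} (e : Sym2 V) (s : Finset ι) (f : ι → V × V → ℝ) (p : V × V) :
    tokenStep e (fun q => ∑ i ∈ s, f i q) p = ∑ i ∈ s, tokenStep e (f i) p := by
  unfold tokenStep
  split_ifs <;> simp

theorem abs_tokenStep (e : Sym2 V) (f : V × V → ℝ) (p : V × V) :
    |tokenStep e f p| = tokenStep e (fun q => |f q|) p := by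
  unfold tokenStep
  split_ifs <;> simp

end TokenPairs

/-! ### A Poincaré inequality along shortest paths. -/

theorem sqDiff_nonneg {V : Type*} (g : V → ℝ) (e : Sym2 V) : 0 ≤ sqDiff g e := by
  induction e with
  | h a b => simpa using sq_nonneg _

theorem abs_sub_le_sum_sqrt_sqDiff {V : Type*} {G : SimpleGraph V} (g : V → ℝ) {u v : V}
    (w : G.Walk u v) : |g u - g v| ≤ (w.edges.map fun e => √(sqDiff g e)).sum := by
  induction w with
  | nil => simp
  | @cons u x v h w ih =>
    simp only [SimpleGraph.Walk.edges_cons, List.map_cons, List.sum_cons, sqDiff_mk,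
      Real.sqrt_sq_eq_abs]
    exact (abs_sub_le _ (g x) _).trans (by gcongr)

section Poincare

variable {V : Type*} [Fintype V] (G : SimpleGraph V) [DecidableRel G.Adj]

/-- A function that vanishes at a vertex is controlled at any other vertex by its Dirichlet
energy along a shortest path. -/
theorem sq_le_diam_mul_sum_sqDiff (hG : G.Connected) (g : V → ℝ) {v : V} (hv : g v = 0) (u : V) :
    g u ^ 2 ≤ G.diam * ∑ e ∈ G.edgeFinset, sqDiff g e := by
  classical
  obtain ⟨w, hw, hlen⟩ := hG.exists_path_of_dist u v
  have hne : Nonempty V := ⟨v⟩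
  have hdist : G.dist u v ≤ G.diam := SimpleGraph.dist_le_diam
    (SimpleGraph.connected_iff_ediam_ne_top.mp hG)
  have hsub : w.edges.toFinset ⊆ G.edgeFinset := by
    intro e he
    rw [SimpleGraph.mem_edgeFinset]
    exact w.edges_subset_edgeSet (List.mem_toFinset.mp he)
  have hcard : (w.edges.toFinset.card : ℝ) ≤ G.diam := by
    have : w.edges.toFinset.card ≤ G.dist u v := by
      refine (List.toFinset_card_le _).trans ?_
      rw [SimpleGraph.Walk.length_edges, hlen]
    exact_mod_cast this.trans hdist
  have h1 : |g u| ≤ ∑ e ∈ w.edges.toFinset, √(sqDiff g e) := by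
    have := abs_sub_le_sum_sqrt_sqDiff g w
    rwa [hv, sub_zero, ← List.sum_toFinset _ hw.isTrail.edges_nodup] at this
  calc g u ^ 2 = |g u| ^ 2 := (sq_abs _).symm
    _ ≤ (∑ e ∈ w.edges.toFinset, √(sqDiff g e)) ^ 2 := by gcongr
    _ ≤ w.edges.toFinset.card * ∑ e ∈ w.edges.toFinset, √(sqDiff g e) ^ 2 :=
        sq_sum_le_card_mul_sum_sq
    _ = w.edges.toFinset.card * ∑ e ∈ w.edges.toFinset, sqDiff g e := by
        simp only [Real.sq_sqrt (sqDiff_nonneg g _)]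
    _ ≤ G.diam * ∑ e ∈ G.edgeFinset, sqDiff g e := by
        gcongr
        · exact Finset.sum_nonneg fun e _ => sqDiff_nonneg g e
        · exact fun e _ _ => sqDiff_nonneg g e

theorem sum_sq_le_card_mul_diam_mul_sum_sqDiff (hG : G.Connected) (g : V → ℝ) {v : V}
    (hv : g v = 0) :
    ∑ u, g u ^ 2 ≤ Fintype.card V * G.diam * ∑ e ∈ G.edgeFinset, sqDiff g e := by
  calc ∑ u, g u ^ 2 ≤ ∑ _u : V, G.diam * ∑ e ∈ G.edgeFinset, sqDiff g e :=
        Finset.sum_le_sum fun u _ => sq_le_diam_mul_sum_sqDiff G hG g hv u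
    _ = _ := by simp [mul_assoc]

end Poincare

/-! ### Spectral gap and `ℓ²` contraction of the killed pair operator. -/

section PairOperator

variable {V : Type*} [DecidableEq V]

/-- The transition operator of two tokens when an edge is selected uniformly from `E`, the tokens
being killed when the edge that joins them is selected. -/
noncomputable def meetOp (E : Finset (Sym2 V)) (f : V × V → ℝ) (p : V × V) : ℝ :=
  (∑ e ∈ E, tokenStep e f p) / E.card

theorem meetOp_nonneg {E : Finset (Sym2 V)} {f : V × V → ℝ} (hf : ∀ p, 0 ≤ f p) (p : V × V) :
    0 ≤ meetOp E f p :=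
  div_nonneg (Finset.sum_nonneg fun _ _ => tokenStep_nonneg hf p) (Nat.cast_nonneg _)

theorem meetOp_le_one {E : Finset (Sym2 V)} {f : V × V → ℝ} (hf : ∀ p, f p ≤ 1) (p : V × V) :
    meetOp E f p ≤ 1 := by
  refine div_le_one_of_le₀ ?_ (Nat.cast_nonneg _)
  simpa using Finset.sum_le_card_nsmul E _ 1 fun e _ => tokenStep_le_one (e := e) hf p

theorem meetOp_diag {E : Finset (Sym2 V)} {f : V × V → ℝ} (hf : ∀ v, f (v, v) = 0) (v : V) :
    meetOp E f (v, v) = 0 := by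
  simp [meetOp, tokenStep_diag hf]

theorem meetOp_sum {ι : Type*} (E : Finset (Sym2 V)) (s : Finset ι) (f : ι → V × V → ℝ)
    (p : V × V) : meetOp E (fun q => ∑ i ∈ s, f i q) p = ∑ i ∈ s, meetOp E (f i) p := by
  simp only [meetOp, tokenStep_sum, ← Finset.sum_div]
  rw [Finset.sum_comm]

theorem meetOp_add (E : Finset (Sym2 V)) (f g : V × V → ℝ) (p : V × V) :
    meetOp E (fun q => f q + g q) p = meetOp E f p + meetOp E g p := by
  simp only [meetOp, tokenStep_add, Finset.sum_add_distrib, add_div]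

theorem meetOp_sub (E : Finset (Sym2 V)) (f g : V × V → ℝ) (p : V × V) :
    meetOp E (fun q => f q - g q) p = meetOp E f p - meetOp E g p := by
  simp only [meetOp, tokenStep_sub, Finset.sum_sub_distrib, sub_div]

theorem meetOp_smul (E : Finset (Sym2 V)) (c : ℝ) (f : V × V → ℝ) (p : V × V) :
    meetOp E (fun q => c * f q) p = c * meetOp E f p := by
  simp only [meetOp, tokenStep_smul, ← Finset.mul_sum, mul_div_assoc]

theorem abs_meetOp_le (E : Finset (Sym2 V)) (f : V × V → ℝ) (p : V × V) :
    |meetOp E f p| ≤ meetOp E (fun q => |f q|) p := by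
  unfold meetOp
  rw [abs_div, Nat.abs_cast]
  gcongr
  refine (Finset.abs_sum_le_sum_abs _ _).trans_eq ?_
  simp only [abs_tokenStep]

variable [Fintype V]

theorem sum_mul_tokenStep_comm (e : Sym2 V) (f g : V × V → ℝ) :
    ∑ p, f p * tokenStep e g p = ∑ p, tokenStep e f p * g p := by
  rw [← Equiv.sum_comp (pairSwap e)]
  refine Finset.sum_congr rfl fun p _ => ?_
  simp only [tokenStep, sym2_pairSwap_eq_iff, pairSwap_pairSwap]
  split_ifs <;> ring

/-- The energy dissipated by selecting the edge `e`. -/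
theorem sum_sqDiff_le_dissipation {e : Sym2 V} (he : ¬ e.IsDiag) {f : V × V → ℝ}
    (hf : ∀ v, f (v, v) = 0) :
    ∑ v, sqDiff (fun u => f (u, v)) e ≤ ∑ p, f p ^ 2 - ∑ p, f p * tokenStep e f p := by
  -- `R` is a pointwise density for twice the dissipation: a squared increment along the swap, or
  -- the full `2 * f p ^ 2` where the pair is killed.
  set R : V × V → ℝ := fun p =>
    if s(p.1, p.2) = e then 2 * f p ^ 2 else (f p - f (pairSwap e p)) ^ 2 with hR
  have hR0 : ∀ p, 0 ≤ R p := by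
    intro p
    simp only [hR]
    split_ifs <;> positivity
  have hsym : ∑ p, (if s(p.1, p.2) = e then 0 else f (pairSwap e p) ^ 2) =
      ∑ p, (if s(p.1, p.2) = e then 0 else f p ^ 2) := by
    rw [← Equiv.sum_comp (pairSwap e)]
    simp only [sym2_pairSwap_eq_iff, pairSwap_pairSwap]
  have hsum : ∑ p, R p = 2 * (∑ p, f p ^ 2 - ∑ p, f p * tokenStep e f p) := by
    have : ∑ p, R p = ∑ p, (2 * f p ^ 2 - 2 * (f p * tokenStep e f p) +
        ((if s(p.1, p.2) = e then 0 else f (pairSwap e p) ^ 2) -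
          (if s(p.1, p.2) = e then 0 else f p ^ 2))) := by
      refine Finset.sum_congr rfl fun p _ => ?_
      simp only [hR, tokenStep]
      split_ifs <;> ring
    rw [this, Finset.sum_add_distrib, Finset.sum_sub_distrib, Finset.sum_sub_distrib, hsym,
      ← Finset.mul_sum, ← Finset.mul_sum]
    ring
  -- For each `v` only the pairs `(a, v)` and `(b, v)` are kept. If `v` is an end of the edge, one
  -- of them is diagonal and the other is killed; killing thus supplies the energy of the edge at
  -- `v`, although the swap moves `v` too.
  have hlow : 2 * ∑ v, sqDiff (fun u => f (u, v)) e ≤ ∑ p, R p := by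
    rw [Fintype.sum_prod_type_right, Finset.mul_sum]
    refine Finset.sum_le_sum fun v _ => ?_
    induction e with
    | h a b =>
      have hab : a ≠ b := he
      have h2 : R (a, v) + R (b, v) ≤ ∑ u, R (u, v) := by
        rw [← Finset.sum_pair (f := fun u => R (u, v)) hab]
        exact Finset.sum_le_sum_of_subset_of_nonneg (Finset.subset_univ _) fun u _ _ => hR0 _
      refine le_trans ?_ h2
      by_cases hva : v = a
      · subst hva
        simp [hR, hf, hab, hab.symm]
      · by_cases hvb : v = b
        · subst hvb
          simp [hR, hf, hab, hab.symm]
        · have hav : Equiv.swap a b v = v := Equiv.swap_apply_of_ne_of_ne hva hvb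
          simp [hR, hva, hvb, hav, hab, hab.symm]
          exact le_of_eq (by ring)
  linarith

theorem sum_mul_meetOp (E : Finset (Sym2 V)) (f g : V × V → ℝ) :
    ∑ p, f p * meetOp E g p = (∑ e ∈ E, ∑ p, f p * tokenStep e g p) / E.card := by
  rw [Finset.sum_comm, Finset.sum_div]
  simp only [meetOp, ← Finset.mul_sum, mul_div_assoc]

theorem sum_mul_meetOp_comm (E : Finset (Sym2 V)) (f g : V × V → ℝ) :
    ∑ p, f p * meetOp E g p = ∑ p, meetOp E f p * g p := by
  have h := sum_mul_meetOp E g f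
  simp only [mul_comm (g _)] at h
  rw [h, sum_mul_meetOp]
  simp only [sum_mul_tokenStep_comm]

/-- The spectral gap of the killed pair operator. -/
theorem sum_mul_meetOp_self_le (G : SimpleGraph V) [DecidableRel G.Adj] (hG : G.Connected)
    {m D : ℝ} (hm0 : 0 < G.edgeFinset.card)
    (hm : (G.edgeFinset.card : ℝ) ≤ m) (hD : (G.diam : ℝ) ≤ D) (hD0 : 0 < D)
    {f : V × V → ℝ} (hf : ∀ v, f (v, v) = 0) :
    ∑ p, f p * meetOp G.edgeFinset f p ≤
      (1 - 1 / (Fintype.card V * D * m)) * ∑ p, f p ^ 2 := by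
  have hV : (0 : ℝ) < Fintype.card V := by
    have := hG.nonempty
    exact_mod_cast Fintype.card_pos
  have hk : (0 : ℝ) < G.edgeFinset.card := by exact_mod_cast hm0
  have hmpos : 0 < m := hk.trans_le hm
  set Q := ∑ p, f p ^ 2 with hQ
  set S := ∑ e ∈ G.edgeFinset, ∑ v, sqDiff (fun u => f (u, v)) e with hS
  have hS0 : 0 ≤ S := Finset.sum_nonneg fun e _ => Finset.sum_nonneg fun v _ => sqDiff_nonneg _ e
  have h1 : Q ≤ Fintype.card V * D * S := by
    have hS' : S = ∑ v, ∑ e ∈ G.edgeFinset, sqDiff (fun u => f (u, v)) e := Finset.sum_comm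
    rw [hQ, hS', Fintype.sum_prod_type_right, Finset.mul_sum]
    refine Finset.sum_le_sum fun v _ => ?_
    refine (sum_sq_le_card_mul_diam_mul_sum_sqDiff G hG (fun u => f (u, v)) (hf v)).trans ?_
    gcongr
    exact Finset.sum_nonneg fun e _ => sqDiff_nonneg _ e
  have h2 : S ≤ G.edgeFinset.card * Q - ∑ e ∈ G.edgeFinset, ∑ p, f p * tokenStep e f p := by
    have : ∀ e ∈ G.edgeFinset, ∑ v, sqDiff (fun u => f (u, v)) e ≤
        Q - ∑ p, f p * tokenStep e f p := fun e he =>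
      sum_sqDiff_le_dissipation (G.not_isDiag_of_mem_edgeFinset he) hf
    refine (Finset.sum_le_sum this).trans_eq ?_
    simp
  rw [sum_mul_meetOp, div_le_iff₀ hk]
  have h3 : Q / (Fintype.card V * D) ≤ S := by
    rw [div_le_iff₀ (by positivity)]
    linarith
  have hQ0 : 0 ≤ Q := Finset.sum_nonneg fun p _ => sq_nonneg _
  have h4 : (G.edgeFinset.card : ℝ) * (1 / (Fintype.card V * D * m) * Q) ≤
      Q / (Fintype.card V * D) := by
    calc (G.edgeFinset.card : ℝ) * (1 / (Fintype.card V * D * m) * Q)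
        ≤ m * (1 / (Fintype.card V * D * m) * Q) := by gcongr
      _ = _ := by field_simp
  linarith

/-- The killed pair operator contracts the `ℓ²` norm of functions vanishing on the diagonal. -/
theorem sum_sq_meetOp_le (G : SimpleGraph V) [DecidableRel G.Adj] (hG : G.Connected)
    {m D : ℝ} (hm0 : 0 < G.edgeFinset.card)
    (hm : (G.edgeFinset.card : ℝ) ≤ m) (hD : (G.diam : ℝ) ≤ D) (hD0 : 0 < D)
    {r : ℝ} (hr : r = 1 - 1 / (Fintype.card V * D * m)) (hr0 : 0 < r)
    {f : V × V → ℝ} (hf : ∀ v, f (v, v) = 0) :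
    ∑ p, meetOp G.edgeFinset f p ^ 2 ≤ r ^ 2 * ∑ p, f p ^ 2 := by
  set A := meetOp G.edgeFinset with hA
  -- The operator has a non-negative kernel, so replacing `g` by `|g|` turns the one-sided bound on
  -- the quadratic form into a two-sided one.
  have habs : ∀ {g : V × V → ℝ}, (∀ v, g (v, v) = 0) →
      |∑ p, g p * A g p| ≤ r * ∑ p, g p ^ 2 := by
    intro g hg
    have h := sum_mul_meetOp_self_le G hG hm0 hm hD hD0 (f := fun p => |g p|)
      (fun v => by simp [hg])
    simp only [sq_abs, ← hr] at h
    refine (Finset.abs_sum_le_sum_abs _ _).trans (le_trans ?_ h)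
    refine Finset.sum_le_sum fun p _ => ?_
    rw [abs_mul]
    gcongr
    exact abs_meetOp_le _ _ _
  set g := A f with hg
  have hg0 : ∀ v, g (v, v) = 0 := fun v => meetOp_diag hf v
  -- Polarisation: for a self-adjoint operator, the bound `r` on the quadratic form becomes a norm
  -- bound when tested on `r * f + A f` and `r * f - A f`.
  have hplus := (abs_le.mp (habs (g := fun p => r * f p + g p) (fun v => by simp [hf, hg0]))).2
  have hminus := (abs_le.mp (habs (g := fun p => r * f p - g p) (fun v => by simp [hf, hg0]))).1
  have hAp : ∀ p, A (fun q => r * f q + g q) p = r * g p + A g p := fun p => by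
    rw [hA, meetOp_add, meetOp_smul]
  have hAm : ∀ p, A (fun q => r * f q - g q) p = r * g p - A g p := fun p => by
    rw [hA, meetOp_sub, meetOp_smul]
  simp only [hAp] at hplus
  simp only [hAm] at hminus
  have hcomm : ∑ p, f p * A g p = ∑ p, g p ^ 2 := by
    rw [hA, sum_mul_meetOp_comm]
    simp only [← hA, ← hg, sq]
  have e1 : ∑ p, (r * f p + g p) * (r * g p + A g p) - ∑ p, (r * f p - g p) * (r * g p - A g p)
      = 4 * r * ∑ p, g p ^ 2 := by
    have : 4 * r * ∑ p, g p ^ 2 = 2 * r * ∑ p, f p * A g p + 2 * r * ∑ p, g p ^ 2 := by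
      rw [hcomm]; ring
    rw [this, ← Finset.sum_sub_distrib, Finset.mul_sum, Finset.mul_sum, ← Finset.sum_add_distrib]
    exact Finset.sum_congr rfl fun p _ => by ring
  have e2 : ∑ p, (r * f p + g p) ^ 2 + ∑ p, (r * f p - g p) ^ 2
      = 2 * r ^ 2 * ∑ p, f p ^ 2 + 2 * ∑ p, g p ^ 2 := by
    rw [← Finset.sum_add_distrib, Finset.mul_sum, Finset.mul_sum, ← Finset.sum_add_distrib]
    exact Finset.sum_congr rfl fun p _ => by ring
  have e3 : 4 * r * ∑ p, g p ^ 2 ≤ r * (2 * r ^ 2 * ∑ p, f p ^ 2 + 2 * ∑ p, g p ^ 2) := by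
    rw [← e1, ← e2]
    linarith
  have e4 : 2 * r * ∑ p, g p ^ 2 ≤ 2 * r * (r ^ 2 * ∑ p, f p ^ 2) := by linarith
  exact le_of_mul_le_mul_left e4 (by positivity)

end PairOperator

/-! ### Decay of the survival probability and its sum over time. -/

section Survival

variable {V : Type*} [DecidableEq V]

/-- The probability that two tokens which start at time `s` at the positions `p` have not met
after `k` steps, when at time `t` an edge is selected uniformly from `E t`. -/
noncomputable def survival (E : ℕ → Finset (Sym2 V)) : ℕ → ℕ → V × V → ℝ
  | 0, _, p => if p.1 = p.2 then 0 else 1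
  | k + 1, s, p => meetOp (E s) (survival E k (s + 1)) p

theorem survival_nonneg (E : ℕ → Finset (Sym2 V)) (k s : ℕ) (p : V × V) :
    0 ≤ survival E k s p := by
  induction k generalizing s p with
  | zero => rw [survival]; split_ifs <;> norm_num
  | succ k ih => exact meetOp_nonneg (fun q => ih _ q) p

theorem survival_le_one (E : ℕ → Finset (Sym2 V)) (k s : ℕ) (p : V × V) :
    survival E k s p ≤ 1 := by
  induction k generalizing s p with
  | zero => rw [survival]; split_ifs <;> norm_num
  | succ k ih => exact meetOp_le_one (fun q => ih _ q) p

theorem survival_diag (E : ℕ → Finset (Sym2 V)) (k s : ℕ) (v : V) :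
    survival E k s (v, v) = 0 := by
  induction k generalizing s v with
  | zero => simp [survival]
  | succ k ih => exact meetOp_diag (fun q => ih _ q) v

theorem sum_survival_succ (E : ℕ → Finset (Sym2 V)) (K s : ℕ) {p : V × V} (hp : p.1 ≠ p.2) :
    ∑ k ∈ Finset.range (K + 1), survival E k s p =
      meetOp (E s) (fun q => ∑ k ∈ Finset.range K, survival E k (s + 1) q) p + 1 := by
  rw [Finset.sum_range_succ', meetOp_sum]
  simp [survival, hp]

theorem sum_sq_survival_le [Fintype V] (G : ℕ → SimpleGraph V) [∀ t, DecidableRel (G t).Adj]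
    {r : ℝ} (hr : ∀ s (f : V × V → ℝ), (∀ v, f (v, v) = 0) →
      ∑ p, meetOp (G s).edgeFinset f p ^ 2 ≤ r ^ 2 * ∑ p, f p ^ 2) (k s : ℕ) :
    ∑ p, survival (fun t => (G t).edgeFinset) k s p ^ 2 ≤ (r ^ k * Fintype.card V) ^ 2 := by
  induction k generalizing s with
  | zero =>
    calc ∑ p, survival (fun t => (G t).edgeFinset) 0 s p ^ 2 ≤ ∑ _p : V × V, (1 : ℝ) := by
          gcongr with p
          exact pow_le_one₀ (survival_nonneg _ _ _ _) (survival_le_one _ _ _ _)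
      _ = _ := by simp [sq]
  | succ k ih =>
    refine (hr s _ (survival_diag _ k (s + 1))).trans ?_
    refine (mul_le_mul_of_nonneg_left (ih (s + 1)) (sq_nonneg r)).trans_eq ?_
    ring

/-- A single value is at most the `ℓ²` norm. The prefactor is the square root of the number of
pairs, hence the later logarithm is of `n`. -/
theorem survival_le_pow [Fintype V] (G : ℕ → SimpleGraph V) [∀ t, DecidableRel (G t).Adj]
    {r : ℝ} (hr0 : 0 ≤ r) (hr : ∀ s (f : V × V → ℝ), (∀ v, f (v, v) = 0) →
      ∑ p, meetOp (G s).edgeFinset f p ^ 2 ≤ r ^ 2 * ∑ p, f p ^ 2) (k s : ℕ) (p : V × V) :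
    survival (fun t => (G t).edgeFinset) k s p ≤ r ^ k * Fintype.card V := by
  refine le_of_sq_le_sq ?_ (by positivity)
  refine le_trans ?_ (sum_sq_survival_le G hr k s)
  exact Finset.single_le_sum (f := fun p => survival (fun t => (G t).edgeFinset) k s p ^ 2)
    (fun q _ => sq_nonneg _) (Finset.mem_univ p)

end Survival

/-- A sequence bounded by `1` and by `N (1 - l) ^ k` has sum at most about `log N / l`. -/
theorem sum_range_le_log_div {a : ℕ → ℝ} {N l : ℝ} (ha0 : ∀ k, 0 ≤ a k) (ha1 : ∀ k, a k ≤ 1)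
    (hN : 1 ≤ N) (hl0 : 0 < l) (hl1 : l ≤ 1) (ha : ∀ k, a k ≤ (1 - l) ^ k * N) (K : ℕ) :
    ∑ k ∈ Finset.range K, a k ≤ Real.log N / l + 1 + 1 / l := by
  -- From time `k₀` on the exponential bound is below `1`: the trivial bound is used before it, a
  -- geometric series after it.
  set k₀ := ⌈Real.log N / l⌉₊ with hk₀
  have hr0 : 0 ≤ 1 - l := by linarith
  have hlog : 0 ≤ Real.log N / l := div_nonneg (Real.log_nonneg hN) hl0.le
  have hsmall : (1 - l) ^ k₀ * N ≤ 1 := by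
    have h1 : (1 - l) ^ k₀ ≤ Real.exp (-Real.log N) := by
      calc (1 - l) ^ k₀ ≤ Real.exp (-l) ^ k₀ := by
            gcongr
            exact Real.one_sub_le_exp_neg l
        _ = Real.exp (-(l * k₀)) := by rw [← Real.exp_nat_mul]; ring_nf
        _ ≤ Real.exp (-Real.log N) := by
            gcongr
            have := Nat.le_ceil (Real.log N / l)
            rw [div_le_iff₀ hl0] at this
            linarith
    rw [Real.exp_neg, Real.exp_log (by linarith)] at h1
    calc (1 - l) ^ k₀ * N ≤ N⁻¹ * N := by gcongr
      _ = 1 := inv_mul_cancel₀ (by linarith)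
  calc ∑ k ∈ Finset.range K, a k ≤ ∑ k ∈ Finset.range (k₀ + K), a k :=
        Finset.sum_le_sum_of_subset_of_nonneg (Finset.range_mono (by lia)) fun k _ _ => ha0 k
    _ = ∑ k ∈ Finset.range k₀, a k + ∑ j ∈ Finset.range K, a (k₀ + j) :=
        Finset.sum_range_add _ _ _
    _ ≤ ∑ k ∈ Finset.range k₀, 1 + ∑ j ∈ Finset.range K, (1 - l) ^ j := by
        gcongr with k _ j _
        · exact ha1 k
        · refine (ha _).trans ?_
          calc (1 - l) ^ (k₀ + j) * N = (1 - l) ^ j * ((1 - l) ^ k₀ * N) := by ring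
            _ ≤ (1 - l) ^ j * 1 := by gcongr
            _ = _ := mul_one _
    _ ≤ (Real.log N / l + 1) + 1 / l := by
        gcongr
        · simpa using (Nat.ceil_lt_add_one hlog).le
        · rw [geom_sum_eq (by linarith), le_div_iff₀ hl0]
          have h0 : (1 - l) ^ K ≥ 0 := pow_nonneg hr0 K
          have h1 : ((1 - l) ^ K - 1) / (1 - l - 1) * l = 1 - (1 - l) ^ K := by
            have : 1 - l - 1 ≠ 0 := by linarith
            field_simp
            ring
          linarith

/-! ### Opinion dynamics and the descent of the deviation. -/

/-- The sum of the squared deviations of the opinions from `c`. -/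
def deviation {V : Type*} [Fintype V] (c : ℤ) (x : V → ℤ) : ℤ := ∑ i, (x i - c) ^ 2

theorem deviation_comp_perm {V : Type*} [Fintype V] (c : ℤ) (x : V → ℤ) (σ : Equiv.Perm V) :
    deviation c (x ∘ σ) = deviation c x :=
  Equiv.sum_comp σ fun i => (x i - c) ^ 2

theorem deviation_nonneg {V : Type*} [Fintype V] (c : ℤ) (x : V → ℤ) : 0 ≤ deviation c x :=
  Finset.sum_nonneg fun _ _ => sq_nonneg _

section Dynamics

variable {V : Type*} [DecidableEq V]

theorem update_mk (x : V → ℤ) (a b : V) : update x s(a, b) = updatePair x a b := rfl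

/-- Opinions that differ by at most one are merely exchanged. -/
theorem updatePair_eq_comp_swap {x : V → ℤ} {a b : V} (h : |x a - x b| ≤ 1) :
    updatePair x a b = x ∘ Equiv.swap a b := by
  rw [abs_le] at h
  funext k
  simp only [updatePair, nudge, Function.comp, Equiv.swap_apply_def]
  split_ifs <;> lia

theorem IsQuantizedConsensus.update {x : V → ℤ} (h : IsQuantizedConsensus x) (e : Sym2 V) :
    IsQuantizedConsensus (update x e) := by
  obtain ⟨c, hc⟩ := h
  induction e with
  | h a b =>
    rw [update_mk, updatePair_eq_comp_swap]
    · exact ⟨c, fun i => hc _⟩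
    · have h1 := hc a
      have h2 := hc b
      rw [abs_le]
      lia

theorem exists_two_le_sub_of_not_isQuantizedConsensus {V : Type*} [Finite V] {x : V → ℤ}
    (h : ¬ IsQuantizedConsensus x) : ∃ u v, 2 ≤ x u - x v := by
  by_contra! hlt
  apply h
  rcases isEmpty_or_nonempty V with hV | hV
  · exact ⟨0, fun i => hV.elim i⟩
  · obtain ⟨v, hv⟩ := Finite.exists_min x
    refine ⟨x v, fun i => ?_⟩
    have := hv i
    have := hlt i v
    lia

/-- The deviation decreases when opinions that differ by at least two meet. -/
theorem deviation_updatePair_lt [Fintype V] (c : ℤ) {x : V → ℤ} {a b : V}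
    (h : 1 < |x a - x b|) : deviation c (updatePair x a b) < deviation c x := by
  have hab : a ≠ b := by
    rintro rfl
    simp at h
  have hdiff : deviation c (updatePair x a b) - deviation c x =
      ∑ i ∈ {a, b}, ((updatePair x a b i - c) ^ 2 - (x i - c) ^ 2) := by
    rw [deviation, deviation, ← Finset.sum_sub_distrib]
    refine (Finset.sum_subset (Finset.subset_univ _) fun i _ hi => ?_).symm
    simp only [Finset.mem_insert, Finset.mem_singleton, not_or] at hi
    simp [updatePair, hi.1, hi.2]
  rw [Finset.sum_pair hab] at hdiff
  simp only [updatePair, hab.symm, if_true, if_false, nudge] at hdiff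
  rcases lt_abs.mp h with h | h
  · rw [if_pos (by lia), if_neg (by lia), if_pos (by lia)] at hdiff
    nlinarith
  · rw [if_neg (by lia), if_pos (by lia), if_pos (by lia)] at hdiff
    nlinarith

open Classical in
/-- The expected number of times in `[s, s + K)` at which there is no quantized consensus, for the
process started from the profile `x` at time `s`. -/
noncomputable def waiting (E : ℕ → Finset (Sym2 V)) : ℕ → ℕ → (V → ℤ) → ℝ
  | 0, _, _ => 0
  | K + 1, s, x => (if IsQuantizedConsensus x then 0 else 1) +
      (∑ e ∈ E s, waiting E K (s + 1) (update x e)) / (E s).card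

theorem waiting_nonneg (E : ℕ → Finset (Sym2 V)) (K s : ℕ) (x : V → ℤ) :
    0 ≤ waiting E K s x := by
  induction K generalizing s x with
  | zero => exact le_rfl
  | succ K ih =>
    refine add_nonneg (by split_ifs <;> norm_num) ?_
    exact div_nonneg (Finset.sum_nonneg fun e _ => ih _ _) (Nat.cast_nonneg _)

theorem waiting_succ_le (E : ℕ → Finset (Sym2 V)) (K s : ℕ) (x : V → ℤ) :
    waiting E (K + 1) s x ≤
      1 + (∑ e ∈ E s, waiting E K (s + 1) (update x e)) / (E s).card := by
  rw [waiting]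
  gcongr
  split_ifs <;> norm_num

theorem waiting_eq_zero (E : ℕ → Finset (Sym2 V)) (K s : ℕ) {x : V → ℤ}
    (hx : IsQuantizedConsensus x) : waiting E K s x = 0 := by
  induction K generalizing s x with
  | zero => rfl
  | succ K ih =>
    rw [waiting, if_pos hx, Finset.sum_eq_zero fun e _ => ih _ (hx.update e)]
    simp

variable [Fintype V]

/-- Until the deviation drops, two tokens that start at opinions differing by at least two have
not met. -/
theorem waiting_le_add_sum_survival (E : ℕ → Finset (Sym2 V)) (hE : ∀ s, (E s).Nonempty) (c : ℤ)
    {N β : ℝ} (hβ0 : 0 ≤ β)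
    (hβ : ∀ K s (y : V → ℤ), (deviation c y : ℝ) ≤ N → waiting E K s y ≤ β)
    (K s : ℕ) {x : V → ℤ} (hx : (deviation c x : ℝ) ≤ N + 1) {u v : V} (huv : 2 ≤ x u - x v) :
    waiting E K s x ≤ β + ∑ k ∈ Finset.range K, survival E k s (u, v) := by
  induction K generalizing s x u v with
  | zero => simpa [waiting] using hβ0
  | succ K ih =>
    have hne : u ≠ v := by
      rintro rfl
      simp at huv
    refine (waiting_succ_le E K s x).trans ?_
    rw [sum_survival_succ E K s (p := (u, v)) hne, meetOp]
    set M : V × V → ℝ := fun q => ∑ k ∈ Finset.range K, survival E k (s + 1) q with hM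
    have hM0 : ∀ q, 0 ≤ M q := fun q => Finset.sum_nonneg fun k _ => survival_nonneg _ _ _ _
    -- If the ends of `e` differ by at most one, the opinions move with the tokens and the deviation
    -- is kept; otherwise the deviation drops and `β` alone suffices.
    have hstep : ∀ e ∈ E s, waiting E K (s + 1) (update x e) ≤ β + tokenStep e M (u, v) := by
      intro e _
      induction e with
      | h a b =>
        rw [update_mk]
        by_cases hab : |x a - x b| ≤ 1
        · have hkill : s(u, v) ≠ s(a, b) := by
            intro h
            rw [abs_le] at hab
            rcases Sym2.eq_iff.mp h with ⟨rfl, rfl⟩ | ⟨rfl, rfl⟩ <;> lia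
          rw [updatePair_eq_comp_swap hab, tokenStep, if_neg hkill]
          refine ih (s + 1) (by rwa [deviation_comp_perm]) ?_
          simpa using huv
        · refine (hβ K (s + 1) _ ?_).trans (le_add_of_nonneg_right (tokenStep_nonneg hM0 _))
          have h1 : deviation c (updatePair x a b) + 1 ≤ deviation c x :=
            deviation_updatePair_lt c (not_le.mp hab)
          have h2 : (deviation c (updatePair x a b) : ℝ) + 1 ≤ deviation c x := by
            exact_mod_cast h1
          linarith
    have hcard : (0 : ℝ) < (E s).card := by exact_mod_cast (hE s).card_pos
    have havg : (∑ e ∈ E s, waiting E K (s + 1) (update x e)) / (E s).card ≤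
        β + (∑ e ∈ E s, tokenStep e M (u, v)) / (E s).card := by
      rw [div_le_iff₀ hcard, add_mul, div_mul_cancel₀ _ hcard.ne']
      refine (Finset.sum_le_sum hstep).trans_eq ?_
      rw [Finset.sum_add_distrib, Finset.sum_const, nsmul_eq_mul, mul_comm]
    linarith

/-- Induction on the integer level of the deviation, each level costing at most one expected meeting
time `B`. At level zero all opinions equal `c`. -/
theorem waiting_le_mul (E : ℕ → Finset (Sym2 V)) (hE : ∀ s, (E s).Nonempty) (c : ℤ)
    {B : ℝ} (hB0 : 0 ≤ B) (hB : ∀ K s p, ∑ k ∈ Finset.range K, survival E k s p ≤ B)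
    (N K s : ℕ) {x : V → ℤ} (hx : (deviation c x : ℝ) ≤ N) : waiting E K s x ≤ B * N := by
  induction N generalizing K s x with
  | zero =>
    have h0 : deviation c x = 0 := by
      refine le_antisymm ?_ (deviation_nonneg c x)
      exact_mod_cast hx
    have hcons : IsQuantizedConsensus x := by
      refine ⟨c, fun i => Or.inl ?_⟩
      have := (Finset.sum_eq_zero_iff_of_nonneg fun i _ => sq_nonneg _).mp h0 i (Finset.mem_univ i)
      have := pow_eq_zero_iff (two_ne_zero) |>.mp this
      lia
    simp [waiting_eq_zero E K s hcons]
  | succ N ih =>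
    push_cast at hx ⊢
    by_cases hcons : IsQuantizedConsensus x
    · rw [waiting_eq_zero E K s hcons]
      positivity
    · obtain ⟨u, v, huv⟩ := exists_two_le_sub_of_not_isQuantizedConsensus hcons
      have h := waiting_le_add_sum_survival E hE c (by positivity : 0 ≤ B * (N : ℝ))
        (fun K s y hy => ih K s hy) K s hx huv
      linarith [hB K s (u, v)]

end Dynamics

/-! ### From the random edges to the recursion: Markov property and expected time. -/

theorem lintegral_uniformOn_edgeSet {V : Type*} [Fintype V] (G : SimpleGraph V)
    [DecidableRel G.Adj] (g : Sym2 V → ℝ≥0∞) :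
    ∫⁻ a, g a ∂(uniformOn G.edgeSet) = (∑ a ∈ G.edgeFinset, g a) / G.edgeFinset.card := by
  classical
  rw [← SimpleGraph.coe_edgeFinset, uniformOn, ProbabilityTheory.cond, lintegral_smul_measure,
    lintegral_finset]
  simp [ENNReal.div_eq_inv_mul, -SimpleGraph.coe_edgeFinset]

section Selection

variable {V : Type*} [Fintype V] [DecidableEq V] {Ω : Type*} {e : ℕ → Ω → Sym2 V}

/-- The profile at time `t` is determined by the edges selected before time `t`. -/
theorem measurable_profile_iSup_comap (x₀ : V → ℤ) (t : ℕ) :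
    Measurable[⨆ i ∈ Set.Iio t, MeasurableSpace.comap (e i) inferInstance]
      fun ω => profile x₀ (fun s => e s ω) t := by
  induction t with
  | zero => exact measurable_const
  | succ t ih =>
    have h1 : Measurable[⨆ i ∈ Set.Iio (t + 1), MeasurableSpace.comap (e i) inferInstance]
        fun ω => profile x₀ (fun s => e s ω) t :=
      ih.mono (biSup_mono fun i hi => lt_trans hi (Nat.lt_succ_self t)) le_rfl
    have h2 : Measurable[⨆ i ∈ Set.Iio (t + 1), MeasurableSpace.comap (e i) inferInstance]
        (e t) :=
      (comap_measurable (e t)).mono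
        (le_biSup (fun i => MeasurableSpace.comap (e i) inferInstance)
          (Set.mem_Iio.mpr (Nat.lt_succ_self t))) le_rfl
    exact (measurable_of_countable fun q : (V → ℤ) × Sym2 V => update q.1 q.2).comp
      (h1.prodMk h2)

variable [MeasurableSpace Ω] {μ : Measure Ω} {G : ℕ → SimpleGraph V}

theorem IsUniformEdgeSelection.measurable_profile (h : IsUniformEdgeSelection G μ e)
    (x₀ : V → ℤ) (t : ℕ) : Measurable fun ω => profile x₀ (fun s => e s ω) t :=
  (measurable_profile_iSup_comap x₀ t).mono
    (iSup₂_le fun i _ => (h.measurable i).comap_le) le_rfl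

/-- The profile uses only the edges of times before `t`, a block disjoint from `{t}` in an
independent family. -/
theorem IsUniformEdgeSelection.indepFun_profile (h : IsUniformEdgeSelection G μ e)
    (x₀ : V → ℤ) (t : ℕ) : IndepFun (fun ω => profile x₀ (fun s => e s ω) t) (e t) μ := by
  have key := indep_iSup_of_disjoint (fun i => (h.measurable i).comap_le) h.indep.iIndep
    (S := Set.Iio t) (T := {t}) (by simp)
  rw [IndepFun_iff_Indep]
  refine indep_of_indep_of_le_left (indep_of_indep_of_le_right key ?_) ?_
  · exact le_biSup (fun i => MeasurableSpace.comap (e i) inferInstance) (Set.mem_singleton t)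
  · exact (measurable_profile_iSup_comap x₀ t).comap_le

/-- The Markov property of the process. -/
theorem IsUniformEdgeSelection.lintegral_profile_succ [∀ t, DecidableRel (G t).Adj]
    [IsProbabilityMeasure μ] (h : IsUniformEdgeSelection G μ e) (x₀ : V → ℤ) (t : ℕ)
    (g : (V → ℤ) → ℝ≥0∞) :
    ∫⁻ ω, g (profile x₀ (fun s => e s ω) (t + 1)) ∂μ =
      ∫⁻ ω, (∑ a ∈ (G t).edgeFinset, g (update (profile x₀ (fun s => e s ω) t) a)) /
        (G t).edgeFinset.card ∂μ := by
  have hX := h.measurable_profile x₀ t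
  have hY := h.measurable t
  have hmap := (indepFun_iff_map_prod_eq_prod_map_map hX.aemeasurable hY.aemeasurable).mp
    (h.indepFun_profile x₀ t)
  have hg : Measurable fun q : (V → ℤ) × Sym2 V => g (update q.1 q.2) := measurable_of_countable _
  have : IsProbabilityMeasure (μ.map (e t)) := Measure.isProbabilityMeasure_map hY.aemeasurable
  calc ∫⁻ ω, g (profile x₀ (fun s => e s ω) (t + 1)) ∂μ
      = ∫⁻ q, g (update q.1 q.2)
          ∂(μ.map fun ω => (profile x₀ (fun s => e s ω) t, e t ω)) :=
        (lintegral_map hg (hX.prodMk hY)).symm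
    _ = ∫⁻ x, ∫⁻ a, g (update x a) ∂(μ.map (e t))
          ∂(μ.map fun ω => profile x₀ (fun s => e s ω) t) := by
        rw [hmap, lintegral_prod _ hg.aemeasurable]
    _ = _ := by
        rw [lintegral_map (measurable_of_countable _) hX]
        simp only [h.law t, lintegral_uniformOn_edgeSet]

open Classical in
theorem IsUniformEdgeSelection.sum_lintegral_eq_waiting [∀ t, DecidableRel (G t).Adj]
    (hG : ∀ t, (G t).edgeFinset.Nonempty)
    [IsProbabilityMeasure μ] (h : IsUniformEdgeSelection G μ e) (x₀ : V → ℤ) (K s : ℕ) :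
    ∑ j ∈ Finset.range K, ∫⁻ ω, (if IsQuantizedConsensus (profile x₀ (fun t => e t ω) (s + j))
        then 0 else 1) ∂μ =
      ∫⁻ ω, ENNReal.ofReal (waiting (fun t => (G t).edgeFinset) K s
        (profile x₀ (fun t => e t ω) s)) ∂μ := by
  induction K generalizing s with
  | zero => simp [waiting]
  | succ K ih =>
    have hmeas : ∀ f : (V → ℤ) → ℝ≥0∞, Measurable fun ω => f (profile x₀ (fun t => e t ω) s) :=
      fun f => (measurable_of_countable f).comp (h.measurable_profile x₀ s)
    rw [Finset.sum_range_succ']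
    have hK := ih (s + 1)
    simp only [add_assoc s 1, add_comm 1] at hK
    rw [hK, add_zero, h.lintegral_profile_succ x₀ s
        (fun y => ENNReal.ofReal (waiting (fun t => (G t).edgeFinset) K (s + 1) y)),
      ← lintegral_add_right _ (hmeas fun y => if IsQuantizedConsensus y then 0 else 1)]
    refine lintegral_congr fun ω => ?_
    have hcard : (0 : ℝ) < (G s).edgeFinset.card := by exact_mod_cast (hG s).card_pos
    rw [waiting, ENNReal.ofReal_add (by split_ifs <;> norm_num)
        (div_nonneg (Finset.sum_nonneg fun _ _ => waiting_nonneg _ _ _ _) hcard.le),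
      ENNReal.ofReal_div_of_pos hcard, ENNReal.ofReal_sum_of_nonneg
        (fun _ _ => waiting_nonneg _ _ _ _), ENNReal.ofReal_natCast, add_comm]
    congr 1
    split_ifs <;> simp

end Selection

-- Every time before the first consensus contributes `1`; if consensus never occurs, both sides are
-- infinite.
open Classical in
theorem convergenceTime_le_tsum {V : Type*} [DecidableEq V] (x₀ : V → ℤ) (e : ℕ → Sym2 V) :
    ((convergenceTime x₀ e : ℕ∞) : ℝ≥0∞) ≤
      ∑' j, if IsQuantizedConsensus (profile x₀ e j) then 0 else 1 := by
  by_cases h : ∃ t, IsQuantizedConsensus (profile x₀ e t)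
  · have hT : convergenceTime x₀ e ≤ (Nat.find h : ℕ∞) :=
      iInf_le_of_le (Nat.find h) (iInf_le_of_le (Nat.find_spec h) le_rfl)
    calc ((convergenceTime x₀ e : ℕ∞) : ℝ≥0∞) ≤ ((Nat.find h : ℕ∞) : ℝ≥0∞) :=
          ENat.toENNReal_le.mpr hT
      _ = ∑ j ∈ Finset.range (Nat.find h),
            if IsQuantizedConsensus (profile x₀ e j) then 0 else 1 := by
          rw [Finset.sum_congr rfl fun j hj =>
            if_neg (Nat.find_min h (Finset.mem_range.mp hj))]
          simp
      _ ≤ _ := ENNReal.sum_le_tsum _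
  · push Not at h
    simp [h]

/-- Bounds on the expected numbers of steps without consensus bound the expected convergence
time. -/
theorem IsUniformEdgeSelection.lintegral_convergenceTime_le {V : Type*} [Fintype V]
    [DecidableEq V] {G : ℕ → SimpleGraph V} [∀ t, DecidableRel (G t).Adj]
    (hG : ∀ t, (G t).edgeFinset.Nonempty) {Ω : Type*} [MeasurableSpace Ω] {μ : Measure Ω}
    [IsProbabilityMeasure μ] {e : ℕ → Ω → Sym2 V} (h : IsUniformEdgeSelection G μ e)
    (x₀ : V → ℤ) {b : ℝ} (hb : ∀ K, waiting (fun t => (G t).edgeFinset) K 0 x₀ ≤ b) :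
    ∫⁻ ω, ((convergenceTime x₀ fun t => e t ω : ℕ∞) : ℝ≥0∞) ∂μ ≤ ENNReal.ofReal b := by
  classical
  refine (lintegral_mono fun ω => convergenceTime_le_tsum x₀ fun t => e t ω).trans ?_
  have hmeas : ∀ j, Measurable fun ω =>
      if IsQuantizedConsensus (profile x₀ (fun t => e t ω) j) then (0 : ℝ≥0∞) else 1 := fun j =>
    (measurable_of_countable fun y : V → ℤ =>
      if IsQuantizedConsensus y then (0 : ℝ≥0∞) else 1).comp (h.measurable_profile x₀ j)
  rw [lintegral_tsum fun j => (hmeas j).aemeasurable, ENNReal.tsum_eq_iSup_nat]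
  refine iSup_le fun K => ?_
  have hK := h.sum_lintegral_eq_waiting hG x₀ K 0
  simp only [zero_add] at hK
  rw [hK]
  simpa [profile] using ENNReal.ofReal_le_ofReal (hb K)

/-! ### Explicit constants and conclusion. -/

theorem abs_sub_iInf_le_spread {n : ℕ} (x : Fin n → ℤ) (i : Fin n) :
    |x i - ⨅ j, x j| ≤ spread x := by
  have h1 : ⨅ j, x j ≤ x i := ciInf_le (Set.finite_range x).bddBelow i
  have h2 : x i ≤ ⨆ j, x j := le_ciSup (Set.finite_range x).bddAbove i
  rw [abs_of_nonneg (by lia), spread]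
  lia

theorem deviation_iInf_le {n : ℕ} (x : Fin n → ℤ) :
    deviation (⨅ j, x j) x ≤ n * spread x ^ 2 := by
  calc deviation (⨅ j, x j) x ≤ ∑ _i : Fin n, spread x ^ 2 :=
        Finset.sum_le_sum fun i _ => sq_le_sq' (abs_le.mp (abs_sub_iInf_le_spread x i)).1
          (abs_le.mp (abs_sub_iInf_le_spread x i)).2
    _ = _ := by simp

/-- The expected meeting time of two tokens. -/
theorem sum_survival_le {n : ℕ} (hn : 2 ≤ n) (G : ℕ → SimpleGraph (Fin n))
    [∀ t, DecidableRel (G t).Adj] (hG : ∀ t, (G t).Connected)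
    (hE : ∀ t, (G t).edgeFinset.Nonempty) (K s : ℕ) (p : Fin n × Fin n) :
    ∑ k ∈ Finset.range K, survival (fun t => (G t).edgeFinset) k s p ≤
      6 * (n * maxEdges G * maxDiam G * Real.log n ^ 2) := by
  have : Nontrivial (Fin n) := Fin.nontrivial_iff_two_le.mpr hn
  have hm : ∀ t, (G t).edgeFinset.card ≤ maxEdges G := fun t => (isGreatest_maxEdges G).2 ⟨t, rfl⟩
  have hD : ∀ t, (G t).diam ≤ maxDiam G := fun t => (isGreatest_maxDiam G).2 ⟨t, rfl⟩
  have hm1 : (1 : ℝ) ≤ maxEdges G := by exact_mod_cast (hE 0).card_pos.trans_le (hm 0)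
  have hD1 : (1 : ℝ) ≤ maxDiam G := by
    have : (G 0).diam ≠ 0 := SimpleGraph.diam_ne_zero_of_ediam_ne_top
      (SimpleGraph.connected_iff_ediam_ne_top.mp (hG 0))
    exact_mod_cast (Nat.pos_of_ne_zero this).trans_le (hD 0)
  have hn2 : (2 : ℝ) ≤ n := by exact_mod_cast hn
  set R : ℝ := n * maxDiam G * maxEdges G with hR
  have hR2 : 2 ≤ R := by
    have : (1 : ℝ) ≤ maxDiam G * maxEdges G := one_le_mul_of_one_le_of_one_le hD1 hm1
    rw [hR, mul_assoc]
    nlinarith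
  -- This keeps the contraction factor `1 - 1 / R` positive.
  have hRinv : 1 / R ≤ 1 / 2 := by gcongr
  have hcontr : ∀ s (f : Fin n × Fin n → ℝ), (∀ v, f (v, v) = 0) →
      ∑ p, meetOp (G s).edgeFinset f p ^ 2 ≤ (1 - 1 / R) ^ 2 * ∑ p, f p ^ 2 := by
    intro s f hf
    exact sum_sq_meetOp_le (G s) (hG s) (m := maxEdges G) (D := maxDiam G) (hE s).card_pos
      (by exact_mod_cast hm s) (by exact_mod_cast hD s) (by linarith)
      (by rw [Fintype.card_fin]) (by linarith) hf
  have h := sum_range_le_log_div (N := n) (l := 1 / R)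
    (fun k => survival_nonneg (fun t => (G t).edgeFinset) k s p)
    (fun k => survival_le_one _ k s p) (by linarith) (by positivity) (by linarith)
    (fun k => by simpa using survival_le_pow G (by linarith) hcontr k s p) K
  refine h.trans ?_
  simp only [div_div_eq_mul_div, div_one, one_mul]
  have hlog : 0.69 ≤ Real.log n := by
    have h1 := Real.log_two_gt_d9
    have h2 : Real.log 2 ≤ Real.log n := Real.log_le_log (by norm_num) hn2
    linarith
  -- Since `R ≥ 2`, the terms `1 + R` are at most `1.5 * R`. As `log n ≥ 0.69`, a second logarithm
  -- and the constant `6` absorb them.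
  have hkey : Real.log n + 1.5 ≤ 6 * Real.log n ^ 2 := by nlinarith
  calc Real.log n * R + 1 + R ≤ R * (Real.log n + 1.5) := by linarith
    _ ≤ R * (6 * Real.log n ^ 2) := by gcongr
    _ = _ := by rw [hR]; ring

end QuantizedConsensus

theorem mainTheorem2 :
    ∃ C : ℝ, 0 < C ∧
      ∀ (n : ℕ) (G : ℕ → SimpleGraph (Fin n)) [∀ t, DecidableRel (G t).Adj],
        (∀ t, (G t).Connected) →
        (∀ t u v, (G t).Adj u v → (G t).degree u + (G t).degree v ≤ (G t).edgeFinset.card) →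
        ∀ (x₀ : Fin n → ℤ), (∀ i, 0 < x₀ i) →
        ∀ (Ω : Type*) [MeasurableSpace Ω] (μ : Measure Ω) [IsProbabilityMeasure μ]
          (e : ℕ → Ω → Sym2 (Fin n)),
          QuantizedConsensus.IsUniformEdgeSelection G μ e →
          ∫⁻ ω, ((QuantizedConsensus.convergenceTime x₀ fun t => e t ω : ℕ∞) : ℝ≥0∞) ∂μ ≤
            ENNReal.ofReal
              (C * (QuantizedConsensus.spread x₀ : ℝ) ^ 2 * (n : ℝ) ^ 2 *
                (QuantizedConsensus.maxEdges G : ℝ) * (QuantizedConsensus.maxDiam G : ℝ) *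
                Real.log n ^ 2) := by
  open QuantizedConsensus in
  refine ⟨6, by norm_num, fun n G _ hG _ x₀ _ Ω _ μ _ e he => ?_⟩
  -- `uniformOn` of the empty set is the zero measure, which is not the law of a random edge. So
  -- every graph has an edge, and `2 ≤ n` follows.
  have hE : ∀ t, (G t).edgeFinset.Nonempty := by
    intro t
    rw [Finset.nonempty_iff_ne_empty, Ne, SimpleGraph.edgeFinset_eq_empty]
    rintro hbot
    have hprob := Measure.isProbabilityMeasure_map (he.measurable t).aemeasurable (μ := μ)
    rw [he.law t, hbot, SimpleGraph.edgeSet_bot, uniformOn_empty_meas] at hprob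
    exact zero_ne_one hprob.measure_univ
  have hn : 2 ≤ n := by
    by_contra hn
    have : Subsingleton (Fin n) := Fin.subsingleton_iff_le_one.mpr (by lia)
    obtain ⟨a, ha⟩ := hE 0
    induction a with
    | h u v => exact (SimpleGraph.mem_edgeFinset.mp ha).ne (Subsingleton.elim u v)
  refine he.lintegral_convergenceTime_le hE x₀ fun K => ?_
  have hdev := deviation_iInf_le x₀
  have hnat : (deviation (⨅ j, x₀ j) x₀ : ℝ) ≤ ((n * (spread x₀).natAbs ^ 2 : ℕ) : ℝ) := by
    have : deviation (⨅ j, x₀ j) x₀ ≤ ((n * (spread x₀).natAbs ^ 2 : ℕ) : ℤ) := by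
      push_cast
      rwa [sq_abs]
    exact (Int.cast_le.mpr this).trans_eq (Int.cast_natCast _)
  refine (waiting_le_mul _ hE _ (by positivity) (sum_survival_le hn G hG hE) _ K 0 hnat).trans_eq ?_
  have hcast : (((spread x₀).natAbs : ℕ) : ℝ) ^ 2 = (spread x₀ : ℝ) ^ 2 := by
    rw [Nat.cast_natAbs, Int.cast_abs, sq_abs]
  push_cast [hcast]
  ring
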